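/- Let $K$ be an infinite field and let $G$ be a finite simple graph with vertex set $V$, where $|V| = n \geq 2$. Let $S = K[x_v, y_v : v \in V]$, let $\mathfrak{m}$ be the ideal of $S$ generated by all the variables, and let $J_G = (x_i y_j - x_j y_i : \{i,j\} \text{ is an edge of } G) \subset S$ be the binomial edge ideal of $G$. For an ideal $I \subset S$, the analytic spread $\ell(I)$ is the Krull dimension of the special fiber ring $S[It]/\mathfrak{m}S[It]$, where $S[It] = \bigoplus_{k \geq 0} I^k t^k$ is the Rees algebra of $I$. If $G$ is connected, then $$n - 1 \leq \ell(J_G) \leq 2n - 3.$$ Both bounds are attained: $\ell(J_{K_n}) = 2n - 3$ for the complete graph $K_n$ on $n$ vertices, and $\ell(J_T) = n - 1$ for every tree $T$ on $n$ vertices. -/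

import Mathlib

/-- The special fiber ring `F(I) = R[It] / 𝔪 R[It]` of an ideal `I` of the polynomial ring
`R = K[x_s | s ∈ σ]`, where `R[It] = ⨁ₙ Iⁿ tⁿ` is the Rees algebra of `I` and `𝔪` is the ideal
generated by the variables of `R`. -/
abbrev SpecialFiberRing {σ K : Type*} [Field K] (I : Ideal (MvPolynomial σ K)) : Type _ :=
  reesAlgebra I ⧸
    (MvPolynomial.idealOfVars σ K).map (algebraMap (MvPolynomial σ K) (reesAlgebra I))

/-- The analytic spread `ℓ(I)`: the Krull dimension of the special fiber ring of `I`. -/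
noncomputable def analyticSpread {σ K : Type*} [Field K] (I : Ideal (MvPolynomial σ K)) :
    WithBot ℕ∞ :=
  ringKrullDim (SpecialFiberRing I)

/-- The binomial `x_i y_j - x_j y_i`; the variable `x_i` is indexed by `Sum.inl i` and the
variable `y_i` by `Sum.inr i`. -/
noncomputable def edgeBinomial {V : Type*} (K : Type*) [Field K] (i j : V) :
    MvPolynomial (V ⊕ V) K :=
  MvPolynomial.X (Sum.inl i) * MvPolynomial.X (Sum.inr j) -
    MvPolynomial.X (Sum.inl j) * MvPolynomial.X (Sum.inr i)

/-- The binomial edge ideal `J_G = (x_i y_j - x_j y_i | {i, j} an edge of G)` of a graph `G`.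
The two orderings of an edge give the same generator up to sign. -/
noncomputable def binomialEdgeIdeal {V : Type*} (K : Type*) [Field K] (G : SimpleGraph V) :
    Ideal (MvPolynomial (V ⊕ V) K) :=
  Ideal.span {f | ∃ i j : V, G.Adj i j ∧ f = edgeBinomial K i j}

/-!
For an ideal `I` generated by a set `s` of forms of one degree `d`, the special fiber ring is the
algebra `K[s]` generated by those forms, so `ℓ(I)` is the transcendence degree of `K[s]`. Two
halves of this are used, and they suffice:

* every special fiber ring is the image of the domain `K[f t | f ∈ s] ⊆ R[t]`, which bounds `ℓ(I)`
  above by a transcendence degree (`analyticSpread_span_le_of_trdeg_le`) and by the number of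
  generators (`analyticSpread_span_le_natCard`);
* the substitution `x_i ↦ x_i u`, `t ↦ u⁻ᵈ` maps the Rees algebra into `R[u]`; setting `u = 0`
  kills the variables and sends `f t` to `f`, so that the special fiber ring maps onto `K[s]`
  (`exists_fiber_algHom`).

Krull dimension and transcendence degree of a finitely generated domain agree by Noether
normalization (`exists_ringKrullDim_eq_and_trdeg_eq`).

Fix vertices `a ≠ b` and put `p i j = x_i y_j - x_j y_i`. By the Plücker relation
`p a b * p i j = p a i * p b j - p a j * p b i`, every `p i j` is algebraic over the subalgebra
generated by the `p a v` and `p b v`, of which `2n - 3` are needed. This gives the upper bound. For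
the complete graph, the specialization `x_a = 1`, `y_a = 0`, `x_b = 0` sends `p a v` to `y_v` and
`p b v` to `-x_v y_b`, and all `2n - 3` remaining variables are algebraic over these images. For a
connected graph, the specialization `y = 1`, `x_r = 0` sends the edge binomials to `x_i - x_j`,
and these generate the whole polynomial ring in the `n - 1` variables `x_v`, `v ≠ r`. Finally a tree
has `n - 1` edges, hence at most `n - 1` generators.
-/

/-! ### Krull dimension and transcendence degree -/

section Dimension

open Algebra

theorem ringKrullDim_eq_of_isIntegral_of_injective (R S : Type*) [CommRing R] [CommRing S]
    [Algebra R S] [Algebra.IsIntegral R S] [FaithfulSMul R S] :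
    ringKrullDim S = ringKrullDim R := by
  refine le_antisymm ?_ (iSup_le fun l ↦ ?_)
  · refine Order.krullDim_le_of_strictMono (PrimeSpectrum.comap (algebraMap R S)) fun P Q h ↦ ?_
    exact Ideal.IsIntegral.comap_lt_comap h
  · obtain ⟨P, _, _⟩ := Ideal.nonempty_primesOver (S := S) l.head.asIdeal
    obtain ⟨L, hL, -⟩ := Ideal.exists_ltSeries_of_hasGoingUp l P
    rw [← hL]
    exact Order.LTSeries.length_le_krullDim L

/-- Krull dimension and transcendence degree agree for a finitely generated domain over a field,
since both are preserved by the integral extension of a Noether normalization. -/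
theorem exists_ringKrullDim_eq_and_trdeg_eq (k A : Type*) [Field k] [CommRing A] [IsDomain A]
    [Algebra k A] [Algebra.FiniteType k A] :
    ∃ d : ℕ, ringKrullDim A = d ∧ Algebra.trdeg k A = d := by
  obtain ⟨d, g, hg, hint⟩ := exists_integral_inj_algHom_of_fg k A
  algebraize [g.toRingHom]
  have : IsScalarTower k (MvPolynomial (Fin d) k) A := .of_algebraMap_eq fun x ↦ (g.commutes x).symm
  have : Algebra.IsIntegral (MvPolynomial (Fin d) k) A := ⟨hint⟩
  have : FaithfulSMul (MvPolynomial (Fin d) k) A :=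
    (faithfulSMul_iff_algebraMap_injective _ _).mpr hg
  refine ⟨d, ?_, ?_⟩
  · rw [ringKrullDim_eq_of_isIntegral_of_injective (MvPolynomial (Fin d) k) A]
    simp
  · have := ((IsTranscendenceBasis.mvPolynomial (Fin d) k).algebraMap_comp
      (A := A)).lift_cardinalMk_eq_trdeg
    simpa using this.symm

theorem ringKrullDim_le_iff_trdeg_le (k : Type*) {A : Type*} [Field k] [CommRing A] [IsDomain A]
    [Algebra k A] [Algebra.FiniteType k A] (m : ℕ) :
    ringKrullDim A ≤ m ↔ Algebra.trdeg k A ≤ m := by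
  obtain ⟨d, h, h'⟩ := exists_ringKrullDim_eq_and_trdeg_eq k A
  rw [h, h']
  norm_cast

theorem le_ringKrullDim_iff_le_trdeg (k : Type*) {A : Type*} [Field k] [CommRing A] [IsDomain A]
    [Algebra k A] [Algebra.FiniteType k A] (m : ℕ) :
    m ≤ ringKrullDim A ↔ m ≤ Algebra.trdeg k A := by
  obtain ⟨d, h, h'⟩ := exists_ringKrullDim_eq_and_trdeg_eq k A
  rw [h, h']
  norm_cast

theorem isAlgebraic_subalgebra_of_mul_mem {k L : Type*} [Field k] [CommRing L] [IsDomain L]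
    [Algebra k L] {D : Subalgebra k L} {a x : L} (ha : a ∈ D) (ha0 : a ≠ 0) (hax : a * x ∈ D) :
    IsAlgebraic D x :=
  .of_mul (mem_nonZeroDivisors_of_ne_zero ha0)
    (isAlgebraic_algebraMap (⟨a, ha⟩ : D)) (isAlgebraic_algebraMap (⟨a * x, hax⟩ : D))

/-- The generators `s` need not contain those of `D`: both subalgebras lie in the algebraic closure
of `D` in `L`, whose transcendence degree is that of `D`. -/
theorem trdeg_adjoin_le_of_forall_isAlgebraic {k L : Type*} [Field k] [CommRing L] [IsDomain L]
    [Algebra k L] (D : Subalgebra k L) (s : Set L) (hs : ∀ x ∈ s, IsAlgebraic D x) :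
    Algebra.trdeg k (Algebra.adjoin k s) ≤ Algebra.trdeg k D := by
  let E : Subalgebra D L := Subalgebra.algebraicClosure D L
  have : FaithfulSMul D E := (faithfulSMul_iff_algebraMap_injective D E).mpr fun a b h ↦
    Subtype.ext (congrArg (fun z : E ↦ (z : L)) h)
  have hle : Algebra.adjoin k s ≤ E.restrictScalars k := Algebra.adjoin_le hs
  calc Algebra.trdeg k (Algebra.adjoin k s) ≤ Algebra.trdeg k (E.restrictScalars k) :=
        trdeg_le_of_injective (Subalgebra.inclusion hle)
          (Subalgebra.inclusion_injective hle)
    _ = Algebra.trdeg k E := rfl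
    _ = Algebra.trdeg k D := by
        rw [← trdeg_add_eq k D (A := E), trdeg_eq_zero (R := D), add_zero]

theorem trdeg_adjoin_range_le {k L ι : Type*} [Field k] [CommRing L] [Algebra k L] [Finite ι]
    (f : ι → L) : Algebra.trdeg k (Algebra.adjoin k (Set.range f)) ≤ Nat.card ι := by
  have : Algebra.adjoin k (Set.range f) = (MvPolynomial.aeval f).range :=
    Algebra.adjoin_range_eq_range_aeval k f
  rw [this]
  have := lift_trdeg_le_of_surjective (MvPolynomial.aeval (R := k) f).rangeRestrict
    (AlgHom.rangeRestrict_surjective _)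
  rw [MvPolynomial.trdeg_of_isDomain] at this
  rw [← Nat.cast_card] at this
  simpa using this

theorem trdeg_top_mvPolynomial (k ι : Type*) [Field k] [Finite ι] :
    trdeg k (⊤ : Subalgebra k (MvPolynomial ι k)) = Nat.card ι := by
  have := (Subalgebra.topEquiv (R := k) (A := MvPolynomial ι k)).lift_trdeg_eq
  rw [MvPolynomial.trdeg_of_isDomain, ← Nat.cast_card] at this
  simpa using this

end Dimension

/-! ### The special fiber ring of an ideal generated by forms of one degree -/

section SpecialFiber

variable {σ K : Type*} [Field K]

/-- The element `f t` of the Rees algebra of the ideal generated by `s`, for `f ∈ s`. -/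
noncomputable def reesGenerator (s : Set (MvPolynomial σ K)) (f : s) : reesAlgebra (Ideal.span s) :=
  ⟨Polynomial.monomial 1 (f : MvPolynomial σ K),
    reesAlgebra.monomial_mem.mpr (by simpa using Ideal.subset_span f.2)⟩

/-- The presentation `K[T_f | f ∈ s] → R[It] / 𝔪 R[It]`, `T_f ↦ f t`, of the special fiber ring of
the ideal `I` generated by `s`. -/
noncomputable def fiberPresentation (s : Set (MvPolynomial σ K)) :
    MvPolynomial s K →ₐ[K] SpecialFiberRing (Ideal.span s) :=
  (Ideal.Quotient.mkₐ K _).comp (MvPolynomial.aeval (reesGenerator s))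

theorem adjoin_range_reesGenerator (s : Set (MvPolynomial σ K)) :
    Algebra.adjoin (MvPolynomial σ K) (Set.range (reesGenerator s)) = ⊤ := by
  apply Subalgebra.map_injective (f := (reesAlgebra (Ideal.span s)).val) Subtype.val_injective
  have h : (reesAlgebra (Ideal.span s)).val '' Set.range (reesGenerator s) =
      (Polynomial.monomial 1 : MvPolynomial σ K →ₗ[MvPolynomial σ K] _) '' s := by
    rw [← Set.range_comp, Set.image_eq_range]
    rfl
  rw [AlgHom.map_adjoin, Algebra.map_top, h, Subalgebra.range_val, ← adjoin_monomial_eq_reesAlgebra,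
    Ideal.span, Submodule.map_span, Algebra.adjoin_span]

/-- The Rees algebra is generated by the `f t` over the polynomial ring, and modulo the variables
a polynomial is its constant coefficient. -/
theorem fiberPresentation_surjective (s : Set (MvPolynomial σ K)) :
    Function.Surjective (fiberPresentation s) := by
  intro q
  obtain ⟨p, rfl⟩ := Ideal.Quotient.mk_surjective q
  have hp : p ∈ Algebra.adjoin (MvPolynomial σ K) (Set.range (reesGenerator s)) := by
    rw [adjoin_range_reesGenerator]; trivial
  change _ ∈ (fiberPresentation s).range
  induction hp using Algebra.adjoin_induction with
  | mem x hx =>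
    obtain ⟨f, rfl⟩ := hx
    exact ⟨MvPolynomial.X f, by simp [fiberPresentation]⟩
  | algebraMap r =>
    refine ⟨MvPolynomial.C (MvPolynomial.constantCoeff r), ?_⟩
    have h : r - MvPolynomial.C (MvPolynomial.constantCoeff r) ∈
        MvPolynomial.idealOfVars σ K := by
      have := MvPolynomial.mem_pow_idealOfVars_iff' 1
        (r - MvPolynomial.C (MvPolynomial.constantCoeff r))
      rw [pow_one] at this
      refine this.mpr fun x hx ↦ ?_
      obtain rfl : x = 0 := by
        rw [← Finsupp.degree_eq_zero_iff]
        omega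
      simp [MvPolynomial.constantCoeff_eq]
    have h' := Ideal.mem_map_of_mem
      (algebraMap (MvPolynomial σ K) (reesAlgebra (Ideal.span s))) h
    rw [map_sub] at h'
    have h'' := (Ideal.Quotient.mk_eq_mk_iff_sub_mem _ _).mpr h'
    rw [h'']
    simp [fiberPresentation]
    rfl
  | add x y _ _ hx hy => rw [map_add]; exact add_mem hx hy
  | mul x y _ _ hx hy => rw [map_mul]; exact mul_mem hx hy

theorem analyticSpread_span_le_natCard (s : Set (MvPolynomial σ K)) [Finite s] :
    analyticSpread (Ideal.span s) ≤ Nat.card s := by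
  refine (ringKrullDim_le_of_surjective (fiberPresentation s).toRingHom
    (fiberPresentation_surjective s)).trans ?_
  simp

theorem analyticSpread_span_le_of_trdeg_le {s : Set (MvPolynomial σ K)} [Finite s]
    {C : Subalgebra K (Polynomial (MvPolynomial σ K))}
    (hs : ∀ f ∈ s, Polynomial.monomial 1 f ∈ C) {m : ℕ} (hC : Algebra.trdeg K C ≤ m) :
    analyticSpread (Ideal.span s) ≤ m := by
  -- `B = K[f t | f ∈ s]`, a finitely generated domain that maps onto the special fiber ring
  let B : Subalgebra K (reesAlgebra (Ideal.span s)) := (MvPolynomial.aeval (reesGenerator s)).range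
  have : Algebra.FiniteType K B :=
    .of_surjective (MvPolynomial.aeval (reesGenerator s)).rangeRestrict
      (AlgHom.rangeRestrict_surjective _)
  have hsurj : Function.Surjective ((Ideal.Quotient.mkₐ K ((MvPolynomial.idealOfVars σ K).map
      (algebraMap (MvPolynomial σ K) (reesAlgebra (Ideal.span s))))).comp B.val) := by
    intro q
    obtain ⟨p, rfl⟩ := fiberPresentation_surjective s q
    exact ⟨⟨_, p, rfl⟩, rfl⟩
  refine (ringKrullDim_le_of_surjective (AlgHom.toRingHom _) hsurj).trans ?_
  refine (ringKrullDim_le_iff_trdeg_le K (A := B) m).mpr (le_trans ?_ hC)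
  let v : reesAlgebra (Ideal.span s) →ₐ[K] Polynomial (MvPolynomial σ K) :=
    (reesAlgebra (Ideal.span s)).val.restrictScalars K
  have hv (p : MvPolynomial s K) : v (MvPolynomial.aeval (reesGenerator s) p) ∈ C := by
    induction p using MvPolynomial.induction_on with
    | C c =>
      rw [MvPolynomial.aeval_C, AlgHom.commutes]
      exact C.algebraMap_mem c
    | add p q hp hq =>
      rw [map_add, map_add]
      exact add_mem hp hq
    | mul_X p f hp =>
      rw [map_mul, map_mul, MvPolynomial.aeval_X]
      exact mul_mem hp (hs f f.2)
  have hB (b : B) : v b ∈ C := by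
    obtain ⟨p, hp⟩ := b.2
    rw [← hp]
    exact hv p
  refine trdeg_le_of_injective ((v.comp B.val).codRestrict C hB) ?_
  intro a b h
  have h' : v a = v b := congrArg (fun z : C ↦ (z : Polynomial (MvPolynomial σ K))) h
  exact Subtype.val_injective (Subtype.val_injective h')

open LaurentPolynomial in
/-- The substitution `x_i ↦ x_i u`, `t ↦ u⁻ᵈ` from `R[t]` to `R[u, u⁻¹]`, where `R` is the polynomial
ring in the `x_i`. The exponent of `u` records the degree for which `x_i` has degree `1` and `t` has
degree `-d`. -/
noncomputable def gradingHom (d : ℕ) :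
    Polynomial (MvPolynomial σ K) →ₐ[K] (MvPolynomial σ K)[T;T⁻¹] :=
  Polynomial.eval₂AlgHom
    (MvPolynomial.aeval fun i ↦ LaurentPolynomial.C (MvPolynomial.X i : MvPolynomial σ K) * T 1)
    (T (-d)) fun _ ↦ Commute.all _ _

open LaurentPolynomial in
theorem gradingHom_monomial_one {d : ℕ} {f : MvPolynomial σ K} (hf : f.IsHomogeneous d) :
    gradingHom d (Polynomial.monomial 1 f) = C f := by
  have hT (n : ℕ) : (T n : (MvPolynomial σ K)[T;T⁻¹]) = T 1 ^ n := by rw [T_pow, mul_one]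
  have : MvPolynomial.aeval
      (fun i ↦ LaurentPolynomial.C (MvPolynomial.X i : MvPolynomial σ K) * T 1) f = C f * T d := by
    conv_lhs => rw [f.as_sum]
    conv_rhs => rw [f.as_sum]
    rw [map_sum, map_sum, Finset.sum_mul]
    refine Finset.sum_congr rfl fun m hm ↦ ?_
    rw [MvPolynomial.aeval_monomial, hf.degree_eq_sum_deg_support hm, MvPolynomial.monomial_eq,
      map_mul, Finsupp.prod, Finsupp.prod, map_prod, mul_assoc, hT,
      ← Finset.prod_pow_eq_pow_sum, ← Finset.prod_mul_distrib]
    simp_rw [mul_pow, map_pow]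
    rfl
  change Polynomial.eval₂ _ _ _ = _
  rw [Polynomial.eval₂_monomial, pow_one]
  exact (congrArg (· * T (-(d : ℤ))) this).trans (by
    rw [mul_assoc, ← T_add, add_neg_cancel, T_zero, mul_one])

open LaurentPolynomial in
theorem gradingHom_C_C (d : ℕ) (c : K) :
    gradingHom d (Polynomial.C (MvPolynomial.C c : MvPolynomial σ K)) =
      C (MvPolynomial.C c : MvPolynomial σ K) :=
  (gradingHom (σ := σ) d).commutes c

open LaurentPolynomial in
theorem gradingHom_C_X (d : ℕ) (i : σ) :
    gradingHom d (Polynomial.C (MvPolynomial.X i : MvPolynomial σ K)) =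
      C (MvPolynomial.X i : MvPolynomial σ K) * T 1 := by
  change Polynomial.eval₂ _ _ _ = _
  rw [Polynomial.eval₂_C]
  exact MvPolynomial.aeval_X _ i

/-- On the Rees algebra of an ideal generated in degree `d` no negative powers of `u` occur. -/
theorem gradingHom_mem_range_toLaurent {s : Set (MvPolynomial σ K)} {d : ℕ}
    (hs : ∀ f ∈ s, f.IsHomogeneous d) (p : reesAlgebra (Ideal.span s)) :
    gradingHom d (p : Polynomial (MvPolynomial σ K)) ∈
      (Polynomial.toLaurentAlg.restrictScalars K).range := by
  have hp : p ∈ Algebra.adjoin (MvPolynomial σ K) (Set.range (reesGenerator s)) := by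
    rw [adjoin_range_reesGenerator]; trivial
  induction hp using Algebra.adjoin_induction with
  | mem x hx =>
    obtain ⟨f, rfl⟩ := hx
    exact ⟨Polynomial.C f,
      (Polynomial.toLaurent_C _).trans (gradingHom_monomial_one (hs f f.2)).symm⟩
  | algebraMap r =>
    change gradingHom d (Polynomial.C r) ∈ _
    induction r using MvPolynomial.induction_on with
    | C c => exact ⟨Polynomial.C (MvPolynomial.C c),
        (Polynomial.toLaurent_C _).trans (gradingHom_C_C d c).symm⟩
    | add p q hp hq => rw [map_add, map_add]; exact add_mem hp hq
    | mul_X p i hp =>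
      rw [map_mul, map_mul]
      refine mul_mem hp ⟨Polynomial.C (MvPolynomial.X i) * Polynomial.X, ?_⟩
      rw [gradingHom_C_X]
      simp
  | add x y _ _ hx hy =>
    rw [Subalgebra.coe_add, map_add]; exact add_mem hx hy
  | mul x y _ _ hx hy =>
    rw [Subalgebra.coe_mul, map_mul]; exact mul_mem hx hy

/-- If `s` consists of forms of degree `d`, then the part of degree `0` of the Rees algebra, for the
grading of `gradingHom`, is a quotient of the special fiber ring isomorphic to `K[s]`. -/
theorem exists_fiber_algHom {s : Set (MvPolynomial σ K)} {d : ℕ}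
    (hs : ∀ f ∈ s, f.IsHomogeneous d) :
    ∃ ρ : SpecialFiberRing (Ideal.span s) →ₐ[K] MvPolynomial σ K,
      ρ.range = Algebra.adjoin K s := by
  let W : Polynomial (MvPolynomial σ K) →ₐ[K] LaurentPolynomial (MvPolynomial σ K) :=
    Polynomial.toLaurentAlg.restrictScalars K
  have hW : Function.Injective W := Polynomial.toLaurent_injective
  let Φ : reesAlgebra (Ideal.span s) →ₐ[K] W.range :=
    ((gradingHom d).comp ((reesAlgebra (Ideal.span s)).val.restrictScalars K)).codRestrict W.range
      (gradingHom_mem_range_toLaurent hs)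
  -- the constant coefficient in `u` of the image under `gradingHom`
  let ρ₀ : reesAlgebra (Ideal.span s) →ₐ[K] MvPolynomial σ K :=
    ((Polynomial.aeval (0 : MvPolynomial σ K)).restrictScalars K).comp
      ((AlgEquiv.ofInjective W hW).symm.toAlgHom.comp Φ)
  have hρ₀ (p : reesAlgebra (Ideal.span s)) (q : Polynomial (MvPolynomial σ K))
      (h : gradingHom d (p : Polynomial (MvPolynomial σ K)) = Polynomial.toLaurent q) :
      ρ₀ p = q.coeff 0 := by
    have h1 : Φ p = AlgEquiv.ofInjective W hW q := Subtype.ext h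
    have h2 : (AlgEquiv.ofInjective W hW).symm (Φ p) = q := by
      rw [h1, AlgEquiv.symm_apply_apply]
    rw [Polynomial.coeff_zero_eq_aeval_zero, ← h2]
    rfl
  have hker : (MvPolynomial.idealOfVars σ K).map
      (algebraMap (MvPolynomial σ K) (reesAlgebra (Ideal.span s))) ≤ RingHom.ker ρ₀ := by
    rw [Ideal.map_le_iff_le_comap, Ideal.span_le]
    rintro _ ⟨i, rfl⟩
    refine (hρ₀ _ (Polynomial.C (MvPolynomial.X i) * Polynomial.X) ?_).trans (by simp)
    refine (gradingHom_C_X d i).trans ?_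
    simp
  refine ⟨Ideal.Quotient.liftₐ _ ρ₀ hker, ?_⟩
  have hcomp : (Ideal.Quotient.liftₐ _ ρ₀ hker).comp (fiberPresentation s) =
      MvPolynomial.aeval Subtype.val := by
    refine MvPolynomial.algHom_ext fun f ↦ ?_
    have : ρ₀ (reesGenerator s f) = f := by
      refine (hρ₀ _ (Polynomial.C f) ?_).trans (by simp)
      exact (gradingHom_monomial_one (hs f f.2)).trans (Polynomial.toLaurent_C _).symm
    rw [MvPolynomial.aeval_X, ← this]
    change ρ₀ (MvPolynomial.aeval (reesGenerator s) (MvPolynomial.X f)) = _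
    rw [MvPolynomial.aeval_X]
  have h := Algebra.adjoin_range_eq_range_aeval K (Subtype.val : s → MvPolynomial σ K)
  rw [Subtype.range_coe] at h
  rw [h, ← hcomp]
  ext x
  constructor
  · rintro ⟨q, rfl⟩
    obtain ⟨p, rfl⟩ := fiberPresentation_surjective s q
    exact ⟨p, rfl⟩
  · rintro ⟨p, rfl⟩
    exact ⟨fiberPresentation s p, rfl⟩

theorem ringKrullDim_adjoin_le_analyticSpread {s : Set (MvPolynomial σ K)} {d : ℕ}
    (hs : ∀ f ∈ s, f.IsHomogeneous d) :
    ringKrullDim (Algebra.adjoin K s) ≤ analyticSpread (Ideal.span s) := by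
  obtain ⟨ρ, hρ⟩ := exists_fiber_algHom hs
  rw [← hρ]
  exact ringKrullDim_le_of_surjective ρ.rangeRestrict.toRingHom ρ.rangeRestrict_surjective

end SpecialFiber

/-! ### Edge binomials and the bounds -/

section BinomialEdgeIdeal

open Algebra

variable {V : Type*}

/-- The edge binomials of `G`, each edge contributing both signs; they generate
`binomialEdgeIdeal K G`. -/
def edgeBinomials (K : Type*) [Field K] (G : SimpleGraph V) : Set (MvPolynomial (V ⊕ V) K) :=
  {f | ∃ i j : V, G.Adj i j ∧ f = edgeBinomial K i j}

theorem edgeBinomials_finite (K : Type*) [Field K] [Finite V] (G : SimpleGraph V) :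
    (edgeBinomials K G).Finite := by
  refine (Set.finite_range fun e : V × V ↦ edgeBinomial K e.1 e.2).subset ?_
  rintro _ ⟨i, j, -, rfl⟩
  exact ⟨(i, j), rfl⟩

variable {K : Type*} [Field K]

theorem edgeBinomial_swap (i j : V) : edgeBinomial K j i = -edgeBinomial K i j := by
  simp [edgeBinomial]

theorem edgeBinomial_self (i : V) : edgeBinomial K i i = 0 := sub_self _

theorem edgeBinomial_plucker (a b i j : V) :
    edgeBinomial K a b * edgeBinomial K i j =
      edgeBinomial K a i * edgeBinomial K b j - edgeBinomial K a j * edgeBinomial K b i := by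
  simp only [edgeBinomial]
  ring

theorem edgeBinomial_ne_zero {a b : V} (h : a ≠ b) : edgeBinomial K a b ≠ 0 := by
  classical
  intro h0
  have := congrArg (MvPolynomial.eval
    (Sum.elim (fun v ↦ if v = a then (1 : K) else 0) (fun v ↦ if v = b then 1 else 0))) h0
  simp [edgeBinomial, h] at this

theorem isHomogeneous_of_mem_edgeBinomials (G : SimpleGraph V) :
    ∀ f ∈ edgeBinomials K G, f.IsHomogeneous 2 := by
  rintro _ ⟨i, j, -, rfl⟩
  exact ((MvPolynomial.isHomogeneous_X K _).mul (MvPolynomial.isHomogeneous_X K _)).sub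
    ((MvPolynomial.isHomogeneous_X K _).mul (MvPolynomial.isHomogeneous_X K _))

/-- The index set of the `p a v` with `v ≠ a` and the `p b v` with `v ≠ a, b`. -/
theorem natCard_ne_sum_ne [Finite V] {a b : V} (hab : a ≠ b) :
    Nat.card ({v // v ≠ a} ⊕ {v // v ≠ a ∧ v ≠ b}) = 2 * Nat.card V - 3 := by
  have h1 : Nat.card {v // v ≠ a} = Nat.card V - 1 := by
    have := Set.ncard_compl ({a} : Set V)
    rwa [Set.ncard_singleton] at this
  have h2 : Nat.card {v // v ≠ a ∧ v ≠ b} = Nat.card V - 2 := by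
    have := Set.ncard_compl ({a, b} : Set V)
    rw [Set.ncard_pair hab] at this
    rw [← this, ← Nat.card_coe_set_eq]
    exact Nat.card_congr (Equiv.subtypeEquivRight fun v ↦ by simp)
  rw [Nat.card_sum, h1, h2]
  omega

theorem analyticSpread_binomialEdgeIdeal_le [Finite V] {a b : V} (hab : a ≠ b)
    (G : SimpleGraph V) :
    analyticSpread (binomialEdgeIdeal K G) ≤ ((2 * Nat.card V - 3 : ℕ) : WithBot ℕ∞) := by
  have := (edgeBinomials_finite K G).to_subtype
  let p (i j : V) : Polynomial (MvPolynomial (V ⊕ V) K) :=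
    Polynomial.monomial 1 (edgeBinomial K i j)
  let g : {v // v ≠ a} ⊕ {v // v ≠ a ∧ v ≠ b} → Polynomial (MvPolynomial (V ⊕ V) K) :=
    Sum.elim (fun v ↦ p a v) (fun v ↦ p b v)
  let D : Subalgebra K _ := adjoin K (Set.range g)
  have ha (j : V) : p a j ∈ D := by
    by_cases h : j = a
    · simp [p, h, edgeBinomial_self]
    · exact subset_adjoin ⟨Sum.inl ⟨j, h⟩, rfl⟩
  have hb (j : V) : p b j ∈ D := by
    by_cases h : j = a
    · have : p b j = -p a b := by simp [p, h, edgeBinomial_swap a b]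
      rw [this]
      exact neg_mem (ha b)
    by_cases h' : j = b
    · simp [p, h', edgeBinomial_self]
    · exact subset_adjoin ⟨Sum.inr ⟨j, h, h'⟩, rfl⟩
  have hp0 : p a b ≠ 0 := by simpa [p] using edgeBinomial_ne_zero hab
  change analyticSpread (Ideal.span (edgeBinomials K G)) ≤ _
  refine analyticSpread_span_le_of_trdeg_le
    (C := adjoin K (Set.range fun e : V × V ↦ p e.1 e.2)) ?_ ?_
  · rintro _ ⟨i, j, -, rfl⟩
    exact subset_adjoin ⟨(i, j), rfl⟩
  · refine (trdeg_adjoin_le_of_forall_isAlgebraic D _ ?_).trans ?_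
    · rintro _ ⟨⟨i, j⟩, rfl⟩
      refine isAlgebraic_subalgebra_of_mul_mem (ha b) hp0 ?_
      have : p a b * p i j = p a i * p b j - p a j * p b i := by
        simp only [p, Polynomial.monomial_mul_monomial]
        rw [edgeBinomial_plucker a b i j, map_sub]
      rw [this]
      exact sub_mem (mul_mem (ha i) (hb j)) (mul_mem (ha j) (hb i))
    · rw [← natCard_ne_sum_ne hab]
      exact trdeg_adjoin_range_le g

/-- Lower bounds for the analytic spread may be checked after a specialization `φ` of the variables. -/
theorem le_analyticSpread_of_le_trdeg_map [Finite V] {S : Type*} [CommRing S] [IsDomain S]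
    [Algebra K S] (φ : MvPolynomial (V ⊕ V) K →ₐ[K] S) (G : SimpleGraph V) {m : ℕ}
    (h : m ≤ trdeg K ((adjoin K (edgeBinomials K G)).map φ)) :
    m ≤ analyticSpread (binomialEdgeIdeal K G) := by
  have : FiniteType K ((adjoin K (edgeBinomials K G)).map φ) := by
    rw [AlgHom.map_adjoin, ← Subalgebra.fg_iff_finiteType]
    exact Subalgebra.fg_def.mpr ⟨_, (edgeBinomials_finite K G).image φ, rfl⟩
  refine (((le_ringKrullDim_iff_le_trdeg K m).mpr h).trans ?_).trans
    (ringKrullDim_adjoin_le_analyticSpread (isHomogeneous_of_mem_edgeBinomials G))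
  refine ringKrullDim_le_of_surjective (((φ.comp (adjoin K (edgeBinomials K G)).val).codRestrict
    ((adjoin K (edgeBinomials K G)).map φ) fun x ↦ ⟨x, x.2, rfl⟩).toRingHom) ?_
  rintro ⟨_, x, hx, rfl⟩
  exact ⟨⟨x, hx⟩, rfl⟩

theorem le_analyticSpread_binomialEdgeIdeal [Finite V] {G : SimpleGraph V} (hG : G.Connected) :
    ((Nat.card V - 1 : ℕ) : WithBot ℕ∞) ≤ analyticSpread (binomialEdgeIdeal K G) := by
  classical
  obtain ⟨r⟩ := hG.nonempty
  let ξ (v : V) : MvPolynomial {v // v ≠ r} K :=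
    if h : v = r then 0 else MvPolynomial.X ⟨v, h⟩
  let φ : MvPolynomial (V ⊕ V) K →ₐ[K] MvPolynomial {v // v ≠ r} K :=
    MvPolynomial.aeval (Sum.elim ξ 1)
  let B := (adjoin K (edgeBinomials K G)).map φ
  have hedge {i j : V} (h : G.Adj i j) : ξ i - ξ j ∈ B :=
    ⟨edgeBinomial K i j, subset_adjoin ⟨i, j, h, rfl⟩, by simp [φ, edgeBinomial]⟩
  have hpath {i j : V} (w : G.Walk i j) : ξ i - ξ j ∈ B := by
    induction w with
    | nil => simp
    | cons h _ ih => simpa using add_mem (hedge h) ih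
  have hξ (v : V) : ξ v ∈ B := by
    obtain ⟨w⟩ := hG.preconnected v r
    simpa [ξ] using hpath w
  have hB : B = ⊤ := by
    rw [_root_.eq_top_iff, ← MvPolynomial.adjoin_range_X, adjoin_le_iff]
    rintro _ ⟨⟨v, hv⟩, rfl⟩
    simpa [ξ, hv] using hξ v
  refine le_analyticSpread_of_le_trdeg_map φ G ?_
  change _ ≤ trdeg K B
  rw [hB, trdeg_top_mvPolynomial, ← Set.ncard_singleton r, ← Set.ncard_compl]
  rfl

theorem le_analyticSpread_binomialEdgeIdeal_completeGraph [Finite V] {a b : V} (hab : a ≠ b) :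
    ((2 * Nat.card V - 3 : ℕ) : WithBot ℕ∞) ≤
      analyticSpread (binomialEdgeIdeal K (SimpleGraph.completeGraph V)) := by
  classical
  let S := MvPolynomial ({v // v ≠ a} ⊕ {v // v ≠ a ∧ v ≠ b}) K
  let x (v : V) : S := if v = a then 1 else
    if h : v ≠ a ∧ v ≠ b then MvPolynomial.X (Sum.inr ⟨v, h⟩) else 0
  let y (v : V) : S := if h : v ≠ a then MvPolynomial.X (Sum.inl ⟨v, h⟩) else 0
  let φ : MvPolynomial (V ⊕ V) K →ₐ[K] S := MvPolynomial.aeval (Sum.elim x y)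
  let B := (adjoin K (edgeBinomials K (SimpleGraph.completeGraph V))).map φ
  have hB (i j : V) (h : i ≠ j) : x i * y j - x j * y i ∈ B :=
    ⟨edgeBinomial K i j, subset_adjoin ⟨i, j, h, rfl⟩, by simp [φ, edgeBinomial]⟩
  have hy (v : {v // v ≠ a}) : (MvPolynomial.X (Sum.inl v) : S) ∈ B := by
    simpa [x, y, v.2] using hB a v v.2.symm
  have hx (v : {v // v ≠ a ∧ v ≠ b}) :
      (MvPolynomial.X (Sum.inl ⟨b, hab.symm⟩) * MvPolynomial.X (Sum.inr v) : S) ∈ B := by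
    simpa [x, y, v.2.1, v.2.2, hab.symm, mul_comm] using hB v b v.2.2
  refine le_analyticSpread_of_le_trdeg_map φ _ ?_
  have := trdeg_adjoin_le_of_forall_isAlgebraic B (Set.range MvPolynomial.X) ?_
  · rwa [MvPolynomial.adjoin_range_X, trdeg_top_mvPolynomial, natCard_ne_sum_ne hab] at this
  rintro _ ⟨v | v, rfl⟩
  · exact isAlgebraic_algebraMap (⟨_, hy v⟩ : B)
  · exact isAlgebraic_subalgebra_of_mul_mem (hy _) (MvPolynomial.X_ne_zero _) (hx v)

theorem analyticSpread_binomialEdgeIdeal_le_natCard_edgeSet [Finite V] (G : SimpleGraph V) :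
    analyticSpread (binomialEdgeIdeal K G) ≤ Nat.card G.edgeSet := by
  -- one generator per edge, for an arbitrary orientation of the edges
  let g (e : G.edgeSet) : MvPolynomial (V ⊕ V) K :=
    edgeBinomial K (Quot.out e.1).1 (Quot.out e.1).2
  have hspan : binomialEdgeIdeal K G = Ideal.span (Set.range g) := by
    refine le_antisymm (Ideal.span_le.mpr ?_) (Ideal.span_mono ?_)
    · rintro _ ⟨i, j, h, rfl⟩
      have hg := Ideal.subset_span (Set.mem_range_self (f := g) ⟨s(i, j), h⟩)
      have he : s((Quot.out s(i, j)).1, (Quot.out s(i, j)).2) = s(i, j) := Quot.out_eq _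
      rcases Sym2.eq_iff.mp he with ⟨h1, h2⟩ | ⟨h1, h2⟩
      · simpa [g, h1, h2] using hg
      · simpa [g, h1, h2, edgeBinomial_swap i j] using hg
    · rintro _ ⟨e, rfl⟩
      refine ⟨_, _, ?_, rfl⟩
      have he : s((Quot.out e.1).1, (Quot.out e.1).2) = e := Quot.out_eq _
      rw [← SimpleGraph.mem_edgeSet, he]
      exact e.2
  rw [hspan]
  refine (analyticSpread_span_le_natCard _).trans ?_
  exact_mod_cast Finite.card_range_le g

end BinomialEdgeIdeal

theorem theorem4p4 {K : Type*} [Field K] [Infinite K] {V : Type*} [Fintype V]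
    (n : ℕ) (hn : 2 ≤ n) (hV : Fintype.card V = n) :
    (∀ G : SimpleGraph V, G.Connected →
      ((n - 1 : ℕ) : WithBot ℕ∞) ≤ analyticSpread (binomialEdgeIdeal K G) ∧
      analyticSpread (binomialEdgeIdeal K G) ≤ ((2 * n - 3 : ℕ) : WithBot ℕ∞)) ∧
    analyticSpread (binomialEdgeIdeal K (SimpleGraph.completeGraph V)) =
      ((2 * n - 3 : ℕ) : WithBot ℕ∞) ∧
    (∀ T : SimpleGraph V, T.IsTree →
      analyticSpread (binomialEdgeIdeal K T) = ((n - 1 : ℕ) : WithBot ℕ∞)) := by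
  obtain ⟨a, b, hab⟩ := Fintype.exists_pair_of_one_lt_card (hV ▸ hn : 1 < Fintype.card V)
  rw [← Nat.card_eq_fintype_card] at hV
  subst hV
  refine ⟨fun G hG ↦ ⟨le_analyticSpread_binomialEdgeIdeal hG,
    analyticSpread_binomialEdgeIdeal_le hab G⟩,
    (analyticSpread_binomialEdgeIdeal_le hab _).antisymm
      (le_analyticSpread_binomialEdgeIdeal_completeGraph hab),
    fun T hT ↦ le_antisymm ?_ (le_analyticSpread_binomialEdgeIdeal hT.connected)⟩
  classical
  refine (analyticSpread_binomialEdgeIdeal_le_natCard_edgeSet T).trans_eq ?_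
  rw [Nat.card_eq_fintype_card, Nat.card_eq_fintype_card, ← hT.card_edgeFinset,
    SimpleGraph.edgeFinset_card, Nat.add_sub_cancel]
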